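/- **Theorem 6.13.** Let $\gamma=(\gamma_j)_{j=0}^\infty\in\ell_2$ be a square summable complex sequence with $|\gamma_j|<1$ for all $j\ge 0$ (that is, $\gamma\in\Gamma\ell_2$). Let $W(z_0,z_1,z_2,\dots)=(z_1,z_2,z_3,\dots)$ be the coshift on $\ell_2$, $D_{\gamma_j}=\sqrt{1-|\gamma_j|^2}$, $\Pi_k=\prod_{j=k}^\infty D_{\gamma_j}$, $L_0(\gamma)=1$ and, for $n\ge1$, $$L_n(\gamma)=\sum_{r=1}^n(-1)^r\sum_{s_1+\dots+s_r=n}\ \sum_{j_1=n-s_1}^\infty\ \sum_{j_2=j_1-s_2}^\infty\cdots\sum_{j_r=j_{r-1}-s_r}^\infty\gamma_{j_1}\overline{\gamma_{j_1+s_1}}\cdots\gamma_{j_r}\overline{\gamma_{j_r+s_r}},$$ where $(s_1,\dots,s_r)$ runs over all ordered $r$-tuples of positive integers with sum $n$. Let $\mathcal L(\gamma)$ and $\mathfrak M(\gamma)$ be the lower triangular infinite matrices whose entries in row $n$ and column $m$ ($n,m\ge1$) are $$\mathcal L(\gamma)_{nm}=\begin{cases}\Pi_n\,L_{n-m}(W^m\gamma),&m\le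 n,\\0,&m>n,\end{cases}\qquad \mathfrak M(\gamma)_{nm}=\begin{cases}-\gamma_m\Bigl(\prod_{l=m+1}^{n-1}D_{\gamma_l}\Bigr)\overline{\gamma_n},&m<n,\\D_{\gamma_n},&m=n,\\0,&m>n,\end{cases}$$ and let $\eta(\gamma)\in\ell_2$ be the column with $n$-th entry $\overline{\gamma_n}\prod_{l=1}^{n-1}D_{\gamma_l}$ ($n\ge1$). Then the matrices $\mathcal L(\gamma)$ and $\mathfrak M(W^k\gamma)$, $k\ge0$, define bounded linear operators on $\ell_2$. With $$\xi_0(\gamma)=\eta(\gamma),\qquad \xi_j(\gamma)=\mathfrak M(\gamma)\,\mathfrak M(W\gamma)\cdots\mathfrak M(W^{j-1}\gamma)\,\eta(W^j\gamma)\quad(j\ge1),$$ the operator $\mathcal A(\gamma)=I-\mathcal L(\gamma)\mathcal L^*(\gamma)$ satisfies $$0\le\mathcal A(\gamma)\le I$$ and has the strongly convergent series decomposition $$\mathcal A(\gamma)=\sum_{j=0}^\infty\xi_j(\gamma)\,\xi_j(\gamma)^*,$$ i.e. $\mathcal A(\gamma)h=\sum_{j=0}^\infty\langle h,\xi_j(\gamma)\rangle\,\xi_j(\gamma)$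 for every $h\in\ell_2$, with unconditional convergence of the series in the norm of $\ell_2$. -/

import Mathlib

open scoped ComplexConjugate InnerProductSpace

noncomputable section

namespace SchurParam

/-- The complex Hilbert space of square summable sequences indexed by `0, 1, 2, …`. -/
abbrev Ell2 : Type := lp (fun _ : ℕ => ℂ) 2

/-- Square summable sequences all of whose entries lie in the open unit disk. -/
def GammaEll2 : Set Ell2 := {γ | ∀ j : ℕ, ‖γ j‖ < 1}

/-- A sequence dominated entrywise by a tail of a square summable one is square summable. -/
theorem memlp_of_norm_le_tail (γ : Ell2) (z : ℕ → ℂ) (h : ∀ n, ‖z n‖ ≤ ‖γ (n + 1)‖) :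
    Memℓp z 2 := by
  have h2 : (0 : ℝ) < (2 : ENNReal).toReal := by norm_num
  refine memℓp_gen ?_
  have hs : Summable fun n : ℕ => ‖γ n‖ ^ (2 : ENNReal).toReal := (lp.memℓp γ).summable h2
  refine Summable.of_nonneg_of_le (fun n => by positivity) (fun n => ?_)
    ((summable_nat_add_iff 1).2 hs)
  exact Real.rpow_le_rpow (norm_nonneg _) (h n) h2.le

/-- The coshift `W (z₀, z₁, z₂, …) = (z₁, z₂, z₃, …)`. -/
def W (z : Ell2) : Ell2 :=
  ⟨fun j => z (j + 1), memlp_of_norm_le_tail z _ fun _ => le_rfl⟩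

/-- `D_{γ_j} = √(1 - |γ_j|²)`. -/
def D (γ : Ell2) (j : ℕ) : ℝ := √(1 - ‖γ j‖ ^ 2)

/-- `Π_k = ∏_{j ≥ k} D_{γ_j}`. -/
def Pi (γ : Ell2) (k : ℕ) : ℝ := ∏' j : ℕ, D γ (k + j)

/-- For a list `(s₁, …, s_r)` of positive integers and `j₀ = m`, the iterated sum
`∑_{j₁ ≥ j₀ - s₁} ∑_{j₂ ≥ j₁ - s₂} ⋯ ∑_{j_r ≥ j_{r-1} - s_r} ∏_i γ_{j_i} conj γ_{j_i + s_i}`.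
If `m = s₁ + ⋯ + s_r`, then `j_{i-1} ≥ s_i + ⋯ + s_r` throughout, so that no subtraction of
natural numbers is truncated. -/
def iterSum (γ : Ell2) : ℕ → List ℕ → ℂ
  | _, [] => 1
  | m, s :: l => ∑' j : Set.Ici (m - s), γ j * conj (γ (j + s)) * iterSum γ j l

/-- `L_n(γ)`, the sum over all ordered tuples `(s₁, …, s_r)` of positive integers with
`s₁ + ⋯ + s_r = n` of `(-1)^r` times the iterated sum with `j₀ = n`. For `n = 0` only the
empty tuple occurs and `L_0(γ) = 1`. -/
def Lcoef (γ : Ell2) (n : ℕ) : ℂ :=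
  ∑ c : Composition n, (-1) ^ c.length * iterSum γ n c.blocks

/-- The matrix `𝓛(γ)`. Its entry in row `n` and column `m`, counted from `1`, is
`Π_n L_{n-m}(W^m γ)` for `m ≤ n` and `0` for `m > n`; here `n = i + 1`, `m = j + 1`. -/
def Lmat (γ : Ell2) : Matrix ℕ ℕ ℂ := Matrix.of fun i j =>
  if j ≤ i then (Pi γ (i + 1) : ℂ) * Lcoef (W^[j + 1] γ) (i - j) else 0

/-- The matrix `𝔐(γ)`. Its entry in row `n` and column `m`, counted from `1`, is `D_{γ_n}` for
`m = n`, `-γ_m (∏_{l=m+1}^{n-1} D_{γ_l}) conj γ_n` for `m < n`, and `0` for `m > n`; here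
`n = i + 1`, `m = j + 1`. -/
def Mmat (γ : Ell2) : Matrix ℕ ℕ ℂ := Matrix.of fun i j =>
  if j = i then (D γ (i + 1) : ℂ)
  else if j < i then
    -(γ (j + 1) * (∏ l ∈ Finset.Ico (j + 2) (i + 1), (D γ l : ℂ)) * conj (γ (i + 1)))
  else 0

theorem D_nonneg (γ : Ell2) (j : ℕ) : 0 ≤ D γ j := Real.sqrt_nonneg _

theorem D_le_one (γ : Ell2) (j : ℕ) : D γ j ≤ 1 :=
  Real.sqrt_le_one.2 (by nlinarith [sq_nonneg ‖γ j‖])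

/-- The vector `η(γ) ∈ ℓ²` whose `n`-th entry, counted from `1`, is
`conj γ_n ∏_{l=1}^{n-1} D_{γ_l}`. -/
def eta (γ : Ell2) : Ell2 :=
  ⟨fun i => conj (γ (i + 1)) * ∏ l ∈ Finset.Ico 1 (i + 1), (D γ l : ℂ), by
    refine memlp_of_norm_le_tail γ _ fun i => ?_
    rw [norm_mul, RCLike.norm_conj, norm_prod]
    refine mul_le_of_le_one_right (norm_nonneg _)
      (Finset.prod_le_one (fun l _ => norm_nonneg _) fun l _ => ?_)
    rw [Complex.norm_real, Real.norm_of_nonneg (D_nonneg γ l)]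
    exact D_le_one γ l⟩

/-- The bounded operator `T` on `ℓ²` acts as multiplication by the infinite matrix `M`. -/
def IsOperatorOf (M : Matrix ℕ ℕ ℂ) (T : Ell2 →L[ℂ] Ell2) : Prop :=
  ∀ (h : Ell2) (i : ℕ), HasSum (fun k : ℕ => M i k * h k) (T h i)

theorem IsOperatorOf.unique {M : Matrix ℕ ℕ ℂ} {S T : Ell2 →L[ℂ] Ell2}
    (hS : IsOperatorOf M S) (hT : IsOperatorOf M T) : S = T := by
  ext h i
  exact (hS h i).unique (hT h i)

/-- The infinite matrix `M` defines a bounded operator on `ℓ²`. -/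
def IsBoundedMatrix (M : Matrix ℕ ℕ ℂ) : Prop := ∃ T : Ell2 →L[ℂ] Ell2, IsOperatorOf M T

open Classical in
/-- The bounded operator on `ℓ²` defined by `M`. It is only meaningful if `IsBoundedMatrix M`;
otherwise the value is `0`. -/
def matrixOp (M : Matrix ℕ ℕ ℂ) : Ell2 →L[ℂ] Ell2 :=
  if h : IsBoundedMatrix M then h.choose else 0

theorem IsBoundedMatrix.isOperatorOf {M : Matrix ℕ ℕ ℂ} (h : IsBoundedMatrix M) :
    IsOperatorOf M (matrixOp M) := by
  rw [matrixOp, dif_pos h]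
  exact h.choose_spec

/-- `𝓛(γ)` as an operator on `ℓ²`. -/
def Lop (γ : Ell2) : Ell2 →L[ℂ] Ell2 := matrixOp (Lmat γ)

/-- `𝔐(γ)` as an operator on `ℓ²`. -/
def Mop (γ : Ell2) : Ell2 →L[ℂ] Ell2 := matrixOp (Mmat γ)

/-- `𝓐(γ) = I - 𝓛(γ) 𝓛(γ)*`. -/
def A (γ : Ell2) : Ell2 →L[ℂ] Ell2 :=
  1 - Lop γ * ContinuousLinearMap.adjoint (Lop γ)

/-- `ξ_j(γ) = 𝔐(γ) 𝔐(Wγ) ⋯ 𝔐(W^{j-1}γ) η(W^j γ)`, in particular `ξ_0(γ) = η(γ)`. -/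
def xi (γ : Ell2) (j : ℕ) : Ell2 :=
  ((List.range j).map fun k => Mop (W^[k] γ)).prod (eta (W^[j] γ))

end SchurParam

end

open scoped ComplexConjugate InnerProductSpace

noncomputable section

namespace SchurParam

open Filter Topology Finset

/-! Everything rests on two identities: `𝓛(γ) = 𝔐(γ) 𝓛(Wγ)` (`lowerApply_Mmat_Lmat`) and `𝔐(γ) 𝔐(γ)*
= I - η(γ) η(γ)*` (`Mop_mul_adjoint`). The first comes from the recursion `Lcoef_eq`, where the
lowest term of the outermost sum is split off. Together they give `𝓐(γ) = η η* + 𝔐(γ) 𝓐(Wγ) 𝔐(γ)*`,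
whose iteration produces the `ξ_j` and a remainder (`A_eq_sum_add`).

Since `‖W^k γ‖ → 0`, the entries of `𝓛(W^k γ)` tend to those of `I`. As `𝔐` is a contraction (a
cascade of plane rotations), so is `𝓛`, which gives `0 ≤ 𝓐 ≤ I`. The same limit makes `𝓐(W^k γ)`
vanish on basis vectors, and triangularity of the `𝔐` factors then kills the remainder strongly
(`tendsto_remainder`). Positivity of the rank one terms upgrades convergence of partial sums to
unconditional convergence. -/

theorem W_apply (γ : Ell2) (j : ℕ) : W γ j = γ (j + 1) := rfl

theorem W_iterate_apply (γ : Ell2) (k j : ℕ) : (W^[k] γ) j = γ (j + k) := by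
  induction k generalizing γ with
  | zero => rfl
  | succ k ih => rw [Function.iterate_succ_apply, ih, W_apply, add_assoc]

theorem W_iterate_mem {γ : Ell2} (hγ : γ ∈ GammaEll2) (k : ℕ) : W^[k] γ ∈ GammaEll2 := fun j => by
  rw [W_iterate_apply]
  exact hγ _

theorem hasSum_norm_sq (γ : Ell2) : HasSum (fun j => ‖γ j‖ ^ 2) (‖γ‖ ^ 2) := by
  have := lp.hasSum_norm (p := 2) (by norm_num) γ
  norm_num at this
  exact this

theorem norm_sq_W_iterate (γ : Ell2) (k : ℕ) :
    ‖W^[k] γ‖ ^ 2 = ∑' j, ‖γ (j + k)‖ ^ 2 := by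
  rw [← (hasSum_norm_sq _).tsum_eq]
  simp only [W_iterate_apply]

theorem tendsto_norm_sq_W_iterate (γ : Ell2) :
    Tendsto (fun k => ‖W^[k] γ‖ ^ 2) atTop (𝓝 0) := by
  simp only [norm_sq_W_iterate]
  exact tendsto_sum_nat_add fun j => ‖γ j‖ ^ 2

theorem norm_sq_W_iterate_le (γ : Ell2) (k : ℕ) : ‖W^[k] γ‖ ^ 2 ≤ ‖γ‖ ^ 2 := by
  rw [norm_sq_W_iterate, ← (hasSum_norm_sq _).tsum_eq,
    ← (hasSum_norm_sq γ).summable.sum_add_tsum_nat_add k]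
  exact le_add_of_nonneg_left (sum_nonneg fun _ _ => by positivity)

/-! ### Iterated sums and the recursion for `L_n` -/

/-- The majorant of the terms of `iterSum`. -/
theorem hasSum_majorant (γ : Ell2) (s : ℕ) (C : ℝ) :
    HasSum (fun j => (‖γ j‖ ^ 2 + ‖γ (j + s)‖ ^ 2) / 2 * C)
      ((‖γ‖ ^ 2 + ‖W^[s] γ‖ ^ 2) / 2 * C) := by
  have h := hasSum_norm_sq (W^[s] γ)
  simp only [W_iterate_apply] at h
  exact (((hasSum_norm_sq γ).add h).div_const 2).mul_right C

theorem norm_term_le (γ : Ell2) (s j : ℕ) {b : ℂ} {C : ℝ} (hb : ‖b‖ ≤ C) :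
    ‖γ j * conj (γ (j + s)) * b‖ ≤ (‖γ j‖ ^ 2 + ‖γ (j + s)‖ ^ 2) / 2 * C := by
  rw [norm_mul, norm_mul, RCLike.norm_conj]
  gcongr
  nlinarith [sq_nonneg (‖γ j‖ - ‖γ (j + s)‖)]

theorem tsum_Ici (f : ℕ → ℂ) (a : ℕ) : ∑' j : Set.Ici a, f j = ∑' i, f (i + a) := by
  let e : ℕ ≃ Set.Ici a :=
    { toFun := fun i => ⟨i + a, Nat.le_add_left _ _⟩
      invFun := fun j => j - a
      left_inv := fun i => by simp
      right_inv := fun j => Subtype.ext (Nat.sub_add_cancel j.2) }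
  exact (e.tsum_eq fun j : Set.Ici a => f j).symm

/-- By `|ab| ≤ (|a|² + |b|²) / 2` each summation costs a factor `‖γ‖²`. The bound does not depend on
the starting index, so the coupling between successive sums is harmless. -/
theorem norm_iterSum_le (γ : Ell2) (m : ℕ) (l : List ℕ) :
    ‖iterSum γ m l‖ ≤ (‖γ‖ ^ 2) ^ l.length := by
  induction l generalizing m with
  | nil => simp [iterSum]
  | cons s l ih =>
    have hg := hasSum_majorant γ s ((‖γ‖ ^ 2) ^ l.length)
    rw [iterSum, tsum_subtype (Set.Ici (m - s))
      (fun j => γ j * conj (γ (j + s)) * iterSum γ j l)]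
    refine (tsum_of_norm_bounded hg fun j => ?_).trans ?_
    · exact (norm_indicator_le_norm_self _ _).trans (norm_term_le γ s j (ih j))
    · rw [List.length_cons, pow_succ' (‖γ‖ ^ 2)]
      have h1 : (‖γ‖ ^ 2 + ‖W^[s] γ‖ ^ 2) / 2 ≤ ‖γ‖ ^ 2 := by
        linarith [norm_sq_W_iterate_le γ s]
      have h2 : 0 ≤ (‖γ‖ ^ 2) ^ l.length := by positivity
      exact mul_le_mul_of_nonneg_right h1 h2

theorem summable_iterSum (γ : Ell2) (s : ℕ) (l : List ℕ) :
    Summable fun j => γ j * conj (γ (j + s)) * iterSum γ j l :=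
  Summable.of_norm_bounded (hasSum_majorant γ s ((‖γ‖ ^ 2) ^ l.length)).summable
    fun j => norm_term_le γ s j (norm_iterSum_le γ j l)

theorem iterSum_cons (γ : Ell2) (m s : ℕ) (l : List ℕ) :
    iterSum γ m (s :: l) = ∑' i, γ (i + (m - s)) * conj (γ (i + (m - s) + s)) *
      iterSum γ (i + (m - s)) l := by
  rw [iterSum, tsum_Ici (fun j => γ j * conj (γ (j + s)) * iterSum γ j l)]

theorem iterSum_cons_eq_add (γ : Ell2) {m s : ℕ} (h : s ≤ m) (l : List ℕ) :
    iterSum γ m (s :: l) =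
      γ (m - s) * conj (γ m) * iterSum γ (m - s) l + iterSum γ (m + 1) (s :: l) := by
  rw [iterSum_cons, iterSum_cons, Summable.tsum_eq_zero_add
    ((summable_nat_add_iff (m - s)).2 (summable_iterSum γ s l)), zero_add, Nat.sub_add_cancel h,
    Nat.sub_add_comm h]
  congr 2
  ext i
  simp only [add_assoc, add_comm 1]

theorem iterSum_W (γ : Ell2) {m : ℕ} {l : List ℕ} (h : l.sum ≤ m) :
    iterSum (W γ) m l = iterSum γ (m + 1) l := by
  induction l generalizing m with
  | nil => rfl
  | cons s l ih =>
    rw [List.sum_cons] at h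
    rw [iterSum_cons, iterSum_cons]
    refine tsum_congr fun i => ?_
    -- The inner index `i + (m - s)` is at least `l.sum`, so no later subtraction is truncated.
    rw [ih (by omega), W_apply, W_apply, Nat.sub_add_comm (by omega : s ≤ m)]
    simp only [add_assoc, add_comm]

/-- Removes the first block; `k` is the sum of the remaining ones. -/
theorem sum_composition_succ (n : ℕ) (f : List ℕ → ℂ) :
    ∑ c : Composition (n + 1), f c.blocks =
      ∑ k ∈ range (n + 1), ∑ c : Composition k, f ((n + 1 - k) :: c.blocks) := by
  rw [sum_sigma']
  symm
  refine sum_bij (fun p hp => ⟨(n + 1 - p.1) :: p.2.blocks, fun {i} hi => ?_, ?_⟩)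
    (fun _ _ => mem_univ _) ?_ ?_ fun _ _ => rfl
  · have := mem_range.1 (mem_sigma.1 hp).1
    rcases List.mem_cons.1 hi with rfl | hi
    · omega
    · exact p.2.blocks_pos hi
  · have := mem_range.1 (mem_sigma.1 hp).1
    rw [List.sum_cons, p.2.blocks_sum]
    omega
  · rintro ⟨k, c⟩ hk ⟨k', c'⟩ hk' h
    simp only [Composition.mk.injEq, List.cons.injEq] at h
    obtain rfl : k = k' := by rw [← c.blocks_sum, ← c'.blocks_sum, h.2]
    rw [Composition.ext h.2]
  · rintro ⟨_ | ⟨s, l⟩, hpos, hsum⟩ -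
    · simp at hsum
    · have hs : 0 < s := hpos (by simp)
      rw [List.sum_cons] at hsum
      refine ⟨⟨l.sum, l, fun hi => hpos (List.mem_cons_of_mem _ hi), rfl⟩, ?_, ?_⟩
      · simp
        omega
      · simp
        omega

theorem Lcoef_zero (γ : Ell2) : Lcoef γ 0 = 1 := by
  have h (c : Composition 0) : c.blocks = [] := c.blocks_eq_nil.2 rfl
  simp [Lcoef, h, iterSum, Composition.length, composition_card]

/-- `L_p(γ) = L_p(Wγ) - conj γ_p ∑_{k < p} γ_k L_k(γ)`. -/
theorem Lcoef_eq (γ : Ell2) (p : ℕ) :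
    Lcoef γ p = Lcoef (W γ) p - conj (γ p) * ∑ k ∈ range p, γ k * Lcoef γ k := by
  rcases p with _ | n
  · simp [Lcoef_zero]
  · have h (δ : Ell2) := sum_composition_succ n fun l => (-1) ^ l.length * iterSum δ (n + 1) l
    simp only [Lcoef, Composition.length] at h ⊢
    rw [h, h, mul_sum, ← sum_sub_distrib]
    refine sum_congr rfl fun k hk => ?_
    have hk := mem_range.1 hk
    rw [mul_sum, mul_sum, ← sum_sub_distrib]
    refine sum_congr rfl fun c _ => ?_
    -- With first block `n + 1 - k` the outer sum starts at `j₁ = k`. That term contributes to `γ_k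
    -- L_k(γ)`, the extra block giving the minus sign; the other terms form the sum for `Wγ`.
    rw [iterSum_cons_eq_add γ (by omega : n + 1 - k ≤ n + 1), iterSum_W γ
      (by rw [List.sum_cons, c.blocks_sum]; omega), Nat.sub_sub_self hk.le, List.length_cons]
    ring

/-- A composition of `n ≠ 0` has a block, so each term is bounded by a positive power of `‖W^k γ‖²`.
-/
theorem tendsto_Lcoef (γ : Ell2) {n : ℕ} (hn : n ≠ 0) :
    Tendsto (fun k => Lcoef (W^[k] γ) n) atTop (𝓝 0) := by
  rw [← sum_const_zero (ι := Composition n) (s := univ)]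
  refine tendsto_finsetSum _ fun c _ => ?_
  have hc : c.blocks.length ≠ 0 := fun h => hn (c.length_eq_zero.1 h)
  have h0 := (tendsto_norm_sq_W_iterate γ).pow c.blocks.length
  rw [zero_pow hc] at h0
  refine squeeze_zero_norm (fun k => ?_) h0
  rw [norm_mul, norm_pow, norm_neg, norm_one, one_pow, one_mul]
  exact norm_iterSum_le _ _ _

/-! ### The numbers `D` and their infinite products -/

theorem D_sq {γ : Ell2} (hγ : γ ∈ GammaEll2) (j : ℕ) : D γ j ^ 2 = 1 - ‖γ j‖ ^ 2 := by
  rw [D, Real.sq_sqrt]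
  nlinarith [hγ j, norm_nonneg (γ j)]

theorem ofReal_D_sq {γ : Ell2} (hγ : γ ∈ GammaEll2) (j : ℕ) :
    (D γ j : ℂ) ^ 2 = 1 - γ j * conj (γ j) := by
  rw [Complex.mul_conj, Complex.normSq_eq_norm_sq, ← Complex.ofReal_pow, D_sq hγ]
  push_cast
  rfl

theorem D_W (γ : Ell2) (j : ℕ) : D (W γ) j = D γ (j + 1) := by
  rw [D, D, W_apply]

theorem one_sub_norm_sq_le_D {γ : Ell2} (hγ : γ ∈ GammaEll2) (j : ℕ) : 1 - ‖γ j‖ ^ 2 ≤ D γ j := by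
  rw [← D_sq hγ]
  nlinarith [D_nonneg γ j, D_le_one γ j]

theorem multipliable_D {γ : Ell2} (hγ : γ ∈ GammaEll2) (k : ℕ) :
    Multipliable fun j => D γ (k + j) := by
  have h : Summable fun j => D γ (k + j) - 1 := by
    refine Summable.of_norm_bounded (g := fun j => ‖γ (k + j)‖ ^ 2) ?_ fun j => ?_
    · simpa only [add_comm] using (summable_nat_add_iff k).2 (hasSum_norm_sq γ).summable
    · rw [Real.norm_eq_abs, abs_le]
      constructor
      · linarith [one_sub_norm_sq_le_D hγ (k + j)]
      · linarith [D_le_one γ (k + j), sq_nonneg ‖γ (k + j)‖]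
  exact (Real.multipliable_one_add_of_summable h).congr fun j => add_sub_cancel _ _

theorem Pi_eq_mul {γ : Ell2} (hγ : γ ∈ GammaEll2) (k : ℕ) : Pi γ k = D γ k * Pi γ (k + 1) := by
  have e (j : ℕ) : D γ (k + (j + 1)) = D γ (k + 1 + j) := by rw [add_assoc, add_comm 1]
  have h : Multipliable fun j => D γ (k + (j + 1)) :=
    (multipliable_D hγ (k + 1)).congr fun j => (e j).symm
  have h2 := tprod_eq_zero_mul' (f := fun j => D γ (k + j)) h
  simp only [e] at h2
  exact h2

theorem Pi_W (γ : Ell2) (k : ℕ) : Pi (W γ) k = Pi γ (k + 1) := by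
  simp only [Pi, D_W]
  exact tprod_congr fun j => congrArg _ (by omega)

theorem Pi_nonneg {γ : Ell2} (hγ : γ ∈ GammaEll2) (k : ℕ) : 0 ≤ Pi γ k :=
  ge_of_tendsto' (multipliable_D hγ k).hasProd fun _ => prod_nonneg fun _ _ => D_nonneg _ _

theorem Pi_le_one {γ : Ell2} (hγ : γ ∈ GammaEll2) (k : ℕ) : Pi γ k ≤ 1 :=
  le_of_tendsto' (multipliable_D hγ k).hasProd fun _ =>
    prod_le_one (fun _ _ => D_nonneg _ _) fun _ _ => D_le_one _ _

theorem one_sub_norm_sq_le_Pi {γ : Ell2} (hγ : γ ∈ GammaEll2) (k : ℕ) :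
    1 - ‖γ‖ ^ 2 ≤ Pi γ k := by
  refine ge_of_tendsto' (multipliable_D hγ k).hasProd fun s => ?_
  -- Weierstrass' product inequality; the induction step uses `(1 - D)(1 - P) ≥ 0`.
  have h1 : 1 - ∑ j ∈ s, ‖γ (k + j)‖ ^ 2 ≤ ∏ j ∈ s, D γ (k + j) := by
    induction s using Finset.induction_on with
    | empty => simp
    | insert a s ha ih =>
      rw [sum_insert ha, prod_insert ha]
      have h2 := one_sub_norm_sq_le_D hγ (k + a)
      have h3 : ∏ j ∈ s, D γ (k + j) ≤ 1 := prod_le_one (fun _ _ => D_nonneg _ _)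
        fun _ _ => D_le_one _ _
      have h4 := D_le_one γ (k + a)
      nlinarith
  have h2 : ∑ j ∈ s, ‖γ (k + j)‖ ^ 2 ≤ ‖γ‖ ^ 2 := by
    rw [← sum_image (g := fun j => k + j) (f := fun j => ‖γ j‖ ^ 2) (by simp)]
    exact sum_le_hasSum _ (fun _ _ => by positivity) (hasSum_norm_sq γ)
  linarith

theorem tendsto_Pi {γ : Ell2} (hγ : γ ∈ GammaEll2) (n : ℕ) :
    Tendsto (fun k => Pi (W^[k] γ) n) atTop (𝓝 1) := by
  refine tendsto_of_tendsto_of_tendsto_of_le_of_le (g := fun k => 1 - ‖W^[k] γ‖ ^ 2) ?_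
    tendsto_const_nhds (fun k => one_sub_norm_sq_le_Pi (W_iterate_mem hγ k) n)
    fun k => Pi_le_one (W_iterate_mem hγ k) n
  simpa using (tendsto_norm_sq_W_iterate γ).const_sub 1

/-! ### Lower triangular contractions -/

/-- The action of the lower triangular part of a matrix on arbitrary sequences. -/
def lowerApply (M : Matrix ℕ ℕ ℂ) (h : ℕ → ℂ) (i : ℕ) : ℂ := ∑ j ∈ range (i + 1), M i j * h j

/-- All leading square truncations of the lower triangular part of `M` are contractions. -/
def IsLowerContraction (M : Matrix ℕ ℕ ℂ) : Prop :=
  ∀ (h : ℕ → ℂ) (N : ℕ), ∑ i ∈ range N, ‖lowerApply M h i‖ ^ 2 ≤ ∑ i ∈ range N, ‖h i‖ ^ 2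

theorem IsLowerContraction.sum_le {M : Matrix ℕ ℕ ℂ} (hM : IsLowerContraction M) (h : Ell2)
    (s : Finset ℕ) : ∑ i ∈ s, ‖lowerApply M h i‖ ^ 2 ≤ ‖h‖ ^ 2 :=
  calc ∑ i ∈ s, ‖lowerApply M h i‖ ^ 2
      ≤ ∑ i ∈ range (s.sup id + 1), ‖lowerApply M h i‖ ^ 2 :=
        sum_le_sum_of_subset_of_nonneg s.subset_range_sup_succ fun _ _ _ => by positivity
    _ ≤ _ := hM h _
    _ ≤ _ := sum_le_hasSum _ (fun _ _ => by positivity) (hasSum_norm_sq h)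

theorem IsLowerContraction.exists_isOperatorOf {M : Matrix ℕ ℕ ℂ} (hM : IsLowerContraction M)
    (hlow : ∀ i j, i < j → M i j = 0) :
    ∃ T : Ell2 →L[ℂ] Ell2, IsOperatorOf M T ∧ ‖T‖ ≤ 1 := by
  have hmem (h : Ell2) : Memℓp (lowerApply M h) 2 :=
    memℓp_gen' (C := ‖h‖ ^ 2) fun s => by
      have := hM.sum_le h s
      norm_num
      exact this
  let T : Ell2 →ₗ[ℂ] Ell2 :=
    { toFun := fun h => ⟨lowerApply M h, hmem h⟩
      map_add' := fun g h => by
        ext i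
        change lowerApply M (g + h) i = lowerApply M g i + lowerApply M h i
        simp [lowerApply, mul_add, sum_add_distrib]
      map_smul' := fun c h => by
        ext i
        change lowerApply M (c • h) i = c * lowerApply M h i
        simp [lowerApply, mul_sum, mul_left_comm] }
  have hT (h : Ell2) : ‖T h‖ ≤ 1 * ‖h‖ := by
    rw [one_mul]
    refine lp.norm_le_of_forall_sum_le (by norm_num) (norm_nonneg _) fun s => ?_
    have := hM.sum_le h s
    norm_num
    exact this
  refine ⟨T.mkContinuous 1 hT, fun h i => ?_, T.mkContinuous_norm_le zero_le_one hT⟩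
  have hs : HasSum (fun k => M i k * h k) (∑ k ∈ range (i + 1), M i k * h k) :=
    hasSum_sum_of_ne_finset_zero fun j hj => by
      rw [hlow i j (by simpa using hj), zero_mul]
  exact hs

theorem isOperatorOf_apply {M : Matrix ℕ ℕ ℂ} {T : Ell2 →L[ℂ] Ell2} (hT : IsOperatorOf M T)
    (hlow : ∀ i j, i < j → M i j = 0) (h : Ell2) (i : ℕ) : T h i = lowerApply M h i :=
  (hT h i).unique <| hasSum_sum_of_ne_finset_zero fun j hj => by
    rw [hlow i j (by simpa using hj), zero_mul]

theorem lowerApply_lowerApply {M L N : Matrix ℕ ℕ ℂ} (hlow : ∀ i j, i < j → L i j = 0)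
    (hN : ∀ i j, lowerApply M (fun k => L k j) i = N i j) (h : ℕ → ℂ) (i : ℕ) :
    lowerApply M (lowerApply L h) i = lowerApply N h i := by
  have h1 (k : ℕ) (hk : k ∈ range (i + 1)) :
      lowerApply L h k = ∑ j ∈ range (i + 1), L k j * h j := by
    have := mem_range.1 hk
    refine sum_subset (range_subset_range.2 (by omega)) fun j _ hj => ?_
    rw [hlow k j (by simpa using hj), zero_mul]
  rw [lowerApply, sum_congr rfl fun k hk => by rw [h1 k hk], lowerApply]
  simp only [← hN, lowerApply, mul_sum, sum_mul]
  rw [sum_comm]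
  simp only [mul_assoc]

/-! ### `𝔐` as a cascade of rotations -/

/-- The state of the cascade of rotations `(h, x) ↦ (D h - conj γ x, D x + γ h)` that realizes
the matrix `𝔐(γ)`. -/
def rotState (γ : Ell2) (h : ℕ → ℂ) : ℕ → ℂ
  | 0 => 0
  | i + 1 => D γ (i + 1) * rotState γ h i + γ (i + 1) * h i

theorem rotState_eq_sum (γ : Ell2) (h : ℕ → ℂ) (i : ℕ) :
    rotState γ h i =
      ∑ j ∈ range i, γ (j + 1) * (∏ l ∈ Ico (j + 2) (i + 1), (D γ l : ℂ)) * h j := by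
  induction i with
  | zero => rfl
  | succ i ih =>
    rw [rotState, ih, sum_range_succ, mul_sum, Ico_self, prod_empty, mul_one]
    congr 1
    refine sum_congr rfl fun j hj => ?_
    have := mem_range.1 hj
    rw [prod_Ico_succ_top (by omega : j + 2 ≤ i + 1)]
    ring

theorem lowerApply_Mmat (γ : Ell2) (h : ℕ → ℂ) (i : ℕ) :
    lowerApply (Mmat γ) h i = D γ (i + 1) * h i - conj (γ (i + 1)) * rotState γ h i := by
  rw [lowerApply, sum_range_succ, rotState_eq_sum, mul_sum, add_comm, sub_eq_add_neg,
    ← sum_neg_distrib]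
  congr 1
  · simp [Mmat]
  · refine sum_congr rfl fun j hj => ?_
    have hj := mem_range.1 hj
    simp only [Mmat, Matrix.of_apply, if_neg hj.ne, if_pos hj]
    ring

theorem norm_rotation {γ : Ell2} (hγ : γ ∈ GammaEll2) (j : ℕ) (h x : ℂ) :
    ‖D γ j * h - conj (γ j) * x‖ ^ 2 + ‖D γ j * x + γ j * h‖ ^ 2 = ‖h‖ ^ 2 + ‖x‖ ^ 2 := by
  apply Complex.ofReal_injective
  push_cast
  simp only [← Complex.mul_conj', map_sub, map_add, map_mul, Complex.conj_conj, Complex.conj_ofReal]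
  linear_combination (h * conj h + x * conj x) * ofReal_D_sq hγ j

theorem isLowerContraction_Mmat {γ : Ell2} (hγ : γ ∈ GammaEll2) :
    IsLowerContraction (Mmat γ) := by
  intro h N
  -- Energy balance: each rotation is unitary and the initial state is zero, so input energy equals
  -- output energy plus the energy left in the state.
  have key : ∑ i ∈ range N, ‖lowerApply (Mmat γ) h i‖ ^ 2 + ‖rotState γ h N‖ ^ 2 =
      ∑ i ∈ range N, ‖h i‖ ^ 2 := by
    induction N with
    | zero => simp [rotState]
    | succ N ih =>
      rw [sum_range_succ, sum_range_succ, ← ih, lowerApply_Mmat, rotState]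
      linear_combination norm_rotation hγ (N + 1) (h N) (rotState γ h N)
  linarith [sq_nonneg ‖rotState γ h N‖]

/-! ### The factorization of `𝓛` and its contractivity -/

theorem Mmat_of_lt (γ : Ell2) (i j : ℕ) (h : i < j) : Mmat γ i j = 0 := by
  simp [Mmat, h.ne', h.le]

theorem Lmat_of_lt (γ : Ell2) (i j : ℕ) (h : i < j) : Lmat γ i j = 0 := by
  simp [Lmat, h]

theorem Lmat_add (γ : Ell2) (p j : ℕ) :
    Lmat γ (j + p) j = Pi γ (j + p + 1) * Lcoef (W^[j + 1] γ) p := by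
  simp [Lmat]

theorem W_iterate_succ_apply (γ : Ell2) (j p : ℕ) : (W^[j + 1] γ) p = γ (j + p + 1) := by
  rw [W_iterate_apply, show p + (j + 1) = j + p + 1 by omega]

theorem Lcoef_W_iterate_succ (γ : Ell2) (j p : ℕ) :
    Lcoef (W^[j + 1] γ) p = Lcoef (W^[j + 1] (W γ)) p -
      conj (γ (j + p + 1)) * ∑ k ∈ range p, (W^[j + 1] γ) k * Lcoef (W^[j + 1] γ) k := by
  rw [Lcoef_eq (W^[j + 1] γ) p, W_iterate_succ_apply, ← Function.iterate_succ_apply' W,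
    Function.iterate_succ_apply W (j + 1)]

/-- Inserting the recursion for `L_p` into the state update, the `|γ|²` terms cancel because `D² = 1
- |γ|²`, leaving the next partial sum. -/
theorem rotState_Lmat {γ : Ell2} (hγ : γ ∈ GammaEll2) (j p : ℕ) :
    rotState γ (fun k => Lmat (W γ) k j) (j + p) =
      Pi γ (j + p + 1) * ∑ k ∈ range p, (W^[j + 1] γ) k * Lcoef (W^[j + 1] γ) k := by
  induction p with
  | zero =>
    rw [rotState_eq_sum, range_zero, sum_empty, mul_zero]
    refine sum_eq_zero fun k hk => ?_
    have : Lmat (W γ) k j = 0 := Lmat_of_lt _ _ _ (by simpa using hk)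
    rw [this, mul_zero]
  | succ p ih =>
    have h1 := ofReal_D_sq hγ (j + p + 1)
    have h2 := Lcoef_W_iterate_succ γ j p
    rw [← add_assoc, rotState, ih, sum_range_succ, Lmat_add, Pi_W, Pi_eq_mul hγ (j + p + 1),
      W_iterate_succ_apply]
    push_cast
    generalize ∑ k ∈ range p, (W^[j + 1] γ) k * Lcoef (W^[j + 1] γ) k = S at *
    rw [h2]
    linear_combination (Pi γ (j + p + 1 + 1) : ℂ) * S * h1

/-- `𝓛(γ) = 𝔐(γ) 𝓛(Wγ)`, column by column. -/
theorem lowerApply_Mmat_Lmat {γ : Ell2} (hγ : γ ∈ GammaEll2) (i j : ℕ) :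
    lowerApply (Mmat γ) (fun k => Lmat (W γ) k j) i = Lmat γ i j := by
  rcases lt_or_ge i j with h | h
  · rw [Lmat_of_lt _ _ _ h]
    refine sum_eq_zero fun k hk => ?_
    have := mem_range.1 hk
    have h0 : Lmat (W γ) k j = 0 := Lmat_of_lt _ _ _ (by omega)
    simp only [h0, mul_zero]
  · obtain ⟨p, rfl⟩ := Nat.exists_eq_add_of_le h
    have h2 := Lcoef_W_iterate_succ γ j p
    rw [lowerApply_Mmat, rotState_Lmat hγ, Lmat_add, Lmat_add, Pi_W, h2,
      Pi_eq_mul hγ (j + p + 1)]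
    push_cast
    ring

theorem tendsto_Lmat {γ : Ell2} (hγ : γ ∈ GammaEll2) (i j : ℕ) :
    Tendsto (fun k => Lmat (W^[k] γ) i j) atTop (𝓝 (if j = i then 1 else 0)) := by
  rcases lt_or_ge i j with h | h
  · simp only [Lmat_of_lt _ _ _ h, if_neg h.ne']
    exact tendsto_const_nhds
  · obtain ⟨p, rfl⟩ := Nat.exists_eq_add_of_le h
    have h1 : Tendsto (fun k => (Pi (W^[k] γ) (j + p + 1) : ℂ)) atTop (𝓝 1) :=
      (Complex.continuous_ofReal.tendsto' 1 1 Complex.ofReal_one).comp (tendsto_Pi hγ (j + p + 1))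
    have h2 : Tendsto (fun k => Lcoef (W^[j + 1] (W^[k] γ)) p) atTop
        (𝓝 (if j = j + p then 1 else 0)) := by
      rcases eq_or_ne p 0 with rfl | hp
      · simp [Lcoef_zero]
      · rw [if_neg (by omega)]
        refine ((tendsto_Lcoef γ hp).comp (tendsto_add_atTop_nat (j + 1))).congr fun k => ?_
        rw [Function.comp_apply, add_comm, Function.iterate_add_apply]
    simp only [Lmat_add]
    simpa using h1.mul h2

/-- Peeling off contractions `𝔐(W^k γ)` can only increase the truncated norm, and the finite
truncations of `𝓛(W^k γ)` tend to the identity. -/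
theorem isLowerContraction_Lmat {γ : Ell2} (hγ : γ ∈ GammaEll2) :
    IsLowerContraction (Lmat γ) := by
  intro h N
  have key (k : ℕ) : ∑ i ∈ range N, ‖lowerApply (Lmat γ) h i‖ ^ 2 ≤
      ∑ i ∈ range N, ‖lowerApply (Lmat (W^[k] γ)) h i‖ ^ 2 := by
    induction k with
    | zero => rfl
    | succ k ih =>
      have hk := W_iterate_mem hγ k
      refine ih.trans ?_
      rw [Function.iterate_succ_apply']
      simp only [← lowerApply_lowerApply (Lmat_of_lt (W (W^[k] γ))) (lowerApply_Mmat_Lmat hk)]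
      exact isLowerContraction_Mmat hk _ N
  refine ge_of_tendsto' (x := atTop) (tendsto_finsetSum _ fun i _ => Tendsto.pow (Tendsto.norm ?_) 2) key
  have := tendsto_finsetSum (range (i + 1)) fun j _ => (tendsto_Lmat hγ i j).mul_const (h j)
  simpa [lowerApply] using this

/-! ### Passage to bounded operators -/

theorem isBoundedMatrix_Mmat {γ : Ell2} (hγ : γ ∈ GammaEll2) : IsBoundedMatrix (Mmat γ) :=
  let ⟨T, hT, _⟩ := (isLowerContraction_Mmat hγ).exists_isOperatorOf (Mmat_of_lt γ)
  ⟨T, hT⟩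

theorem isBoundedMatrix_Lmat {γ : Ell2} (hγ : γ ∈ GammaEll2) : IsBoundedMatrix (Lmat γ) :=
  let ⟨T, hT, _⟩ := (isLowerContraction_Lmat hγ).exists_isOperatorOf (Lmat_of_lt γ)
  ⟨T, hT⟩

theorem norm_Mop_le {γ : Ell2} (hγ : γ ∈ GammaEll2) : ‖Mop γ‖ ≤ 1 := by
  obtain ⟨T, hT, h1⟩ := (isLowerContraction_Mmat hγ).exists_isOperatorOf (Mmat_of_lt γ)
  rwa [Mop, (isBoundedMatrix_Mmat hγ).isOperatorOf.unique hT]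

theorem norm_Lop_le {γ : Ell2} (hγ : γ ∈ GammaEll2) : ‖Lop γ‖ ≤ 1 := by
  obtain ⟨T, hT, h1⟩ := (isLowerContraction_Lmat hγ).exists_isOperatorOf (Lmat_of_lt γ)
  rwa [Lop, (isBoundedMatrix_Lmat hγ).isOperatorOf.unique hT]

theorem Mop_apply {γ : Ell2} (hγ : γ ∈ GammaEll2) (h : Ell2) (i : ℕ) :
    Mop γ h i = lowerApply (Mmat γ) h i :=
  isOperatorOf_apply (isBoundedMatrix_Mmat hγ).isOperatorOf (Mmat_of_lt γ) h i

theorem Lop_apply {γ : Ell2} (hγ : γ ∈ GammaEll2) (h : Ell2) (i : ℕ) :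
    Lop γ h i = lowerApply (Lmat γ) h i :=
  isOperatorOf_apply (isBoundedMatrix_Lmat hγ).isOperatorOf (Lmat_of_lt γ) h i

theorem W_mem {γ : Ell2} (hγ : γ ∈ GammaEll2) : W γ ∈ GammaEll2 := fun j => hγ (j + 1)

theorem Lop_eq_mul {γ : Ell2} (hγ : γ ∈ GammaEll2) : Lop γ = Mop γ * Lop (W γ) := by
  ext h i
  rw [mul_apply_eq_comp, Mop_apply hγ, Lop_apply hγ,
    ← lowerApply_lowerApply (Lmat_of_lt (W γ)) (lowerApply_Mmat_Lmat hγ)]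
  congr 1
  ext k
  exact (Lop_apply (W_mem hγ) h k).symm

/-! ### The defect of `𝔐*` -/

/-- The input is column `j` of `𝔐*`. The product of the two `Ico 1` factors will yield `η η*`; the
subtracted term is present only until the input ends. -/
theorem rotState_conj_Mmat {γ : Ell2} (hγ : γ ∈ GammaEll2) (i j : ℕ) :
    rotState γ (fun k => conj (Mmat γ j k)) i =
      γ (j + 1) * ((∏ l ∈ Ico 1 (i + 1), (D γ l : ℂ)) * ∏ l ∈ Ico 1 (j + 1), (D γ l : ℂ) -
        if i ≤ j then ∏ l ∈ Ico (i + 1) (j + 1), (D γ l : ℂ) else 0) := by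
  induction i with
  | zero => simp [rotState]
  | succ i ih =>
    have hD := ofReal_D_sq hγ (i + 1)
    rw [rotState, ih, prod_Ico_succ_top (by omega : 1 ≤ i + 1)]
    rcases lt_trichotomy i j with h | rfl | h
    · rw [if_pos h.le, if_pos (by omega : i + 1 ≤ j), prod_eq_prod_Ico_succ_bot
        (by omega : i + 1 < j + 1)]
      simp only [Mmat, Matrix.of_apply, if_neg h.ne, if_pos h, map_neg, map_mul, map_prod,
        Complex.conj_ofReal, Complex.conj_conj]
      linear_combination (-γ (j + 1) * ∏ l ∈ Ico (i + 2) (j + 1), (D γ l : ℂ)) * hD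
    · rw [if_pos le_rfl, if_neg (by omega), Ico_self, prod_empty]
      simp only [Mmat, Matrix.of_apply, if_true, Complex.conj_ofReal]
      ring
    · rw [if_neg (by omega), if_neg (by omega), Mmat_of_lt _ _ _ h, map_zero]
      ring

theorem eta_apply (γ : Ell2) (i : ℕ) :
    eta γ i = conj (γ (i + 1)) * ∏ l ∈ Ico 1 (i + 1), (D γ l : ℂ) := rfl

theorem lowerApply_Mmat_conj_Mmat {γ : Ell2} (hγ : γ ∈ GammaEll2) (i j : ℕ) :
    lowerApply (Mmat γ) (fun k => conj (Mmat γ j k)) i =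
      (if i = j then 1 else 0) - eta γ i * conj (eta γ j) := by
  rw [lowerApply_Mmat, rotState_conj_Mmat hγ]
  simp only [eta_apply, map_mul, map_prod, Complex.conj_conj, Complex.conj_ofReal]
  rcases lt_trichotomy i j with h | rfl | h
  · rw [if_pos h.le, if_neg h.ne, prod_eq_prod_Ico_succ_bot (by omega : i + 1 < j + 1)]
    simp only [Mmat, Matrix.of_apply, if_neg h.ne, if_pos h, map_neg, map_mul, map_prod,
      Complex.conj_ofReal, Complex.conj_conj]
    ring
  · rw [if_pos le_rfl, if_pos rfl, Ico_self, prod_empty]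
    simp only [Mmat, Matrix.of_apply, if_true, Complex.conj_ofReal]
    linear_combination ofReal_D_sq hγ (i + 1)
  · rw [if_neg (by omega), if_neg h.ne', Mmat_of_lt _ _ _ h, map_zero]
    ring

/-! ### Contractions and rank one series in Hilbert space -/

open InnerProductSpace ContinuousLinearMap

section Hilbert

variable {E : Type*} [NormedAddCommGroup E] [InnerProductSpace ℂ E]

/-- Pair the sum `y` with itself, apply Cauchy–Schwarz and the Bessel bound at `y`, then cancel
`‖y‖²`. -/
theorem norm_sum_rankOne_sq_le {ξ : ℕ → E} {C : ℝ}
    (hC : ∀ (x : E) (s : Finset ℕ), ∑ j ∈ s, ‖⟪ξ j, x⟫_ℂ‖ ^ 2 ≤ C * ‖x‖ ^ 2) (x : E)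
    (s : Finset ℕ) :
    ‖∑ j ∈ s, rankOne ℂ (ξ j) (ξ j) x‖ ^ 2 ≤ C * ∑ j ∈ s, ‖⟪ξ j, x⟫_ℂ‖ ^ 2 := by
  set y := ∑ j ∈ s, rankOne ℂ (ξ j) (ξ j) x with hy
  have h1 : ‖y‖ ^ 2 ≤ ∑ j ∈ s, ‖⟪ξ j, x⟫_ℂ‖ * ‖⟪ξ j, y⟫_ℂ‖ := by
    rw [← @inner_self_eq_norm_sq ℂ]
    nth_rw 1 [hy]
    refine (RCLike.re_le_norm _).trans ?_
    rw [sum_inner]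
    refine (norm_sum_le _ _).trans_eq (sum_congr rfl fun j _ => ?_)
    rw [rankOne_apply, inner_smul_left, norm_mul, RCLike.norm_conj]
  have h2 := sum_mul_sq_le_sq_mul_sq s (fun j => ‖⟪ξ j, x⟫_ℂ‖) fun j => ‖⟪ξ j, y⟫_ℂ‖
  have h3 : 0 ≤ ∑ j ∈ s, ‖⟪ξ j, x⟫_ℂ‖ ^ 2 := sum_nonneg fun _ _ => by positivity
  have h4 : (‖y‖ ^ 2) ^ 2 ≤ (C * ∑ j ∈ s, ‖⟪ξ j, x⟫_ℂ‖ ^ 2) * ‖y‖ ^ 2 :=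
    calc (‖y‖ ^ 2) ^ 2 ≤ _ := pow_le_pow_left₀ (by positivity) h1 2
      _ ≤ _ := h2
      _ ≤ _ := mul_le_mul_of_nonneg_left (hC y s) h3
      _ = _ := by ring
  rcases (sq_nonneg ‖y‖).eq_or_lt with h | h
  · rw [← h]
    -- The sign of `C` is not assumed; for `x ≠ 0` the Bessel bound forces `C ≥ 0`.
    have h5 := (hC x s).trans' h3
    rcases eq_or_ne x 0 with rfl | hx
    · simp
    · exact mul_nonneg (nonneg_of_mul_nonneg_left h5 (by positivity)) h3
  · rw [sq (‖y‖ ^ 2)] at h4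
    exact le_of_mul_le_mul_right h4 h

variable [CompleteSpace E]

theorem norm_sub_apply_adjoint_sq_le {T : E →L[ℂ] E} (hT : ‖T‖ ≤ 1) (x : E) :
    ‖x - T (adjoint T x)‖ ^ 2 ≤ ‖x‖ ^ 2 - ‖adjoint T x‖ ^ 2 := by
  have h1 : ‖T (adjoint T x)‖ ≤ ‖adjoint T x‖ := by
    simpa using T.le_of_opNorm_le hT (adjoint T x)
  have h2 : RCLike.re ⟪x, T (adjoint T x)⟫_ℂ = ‖adjoint T x‖ ^ 2 := by
    rw [← adjoint_inner_left, inner_self_eq_norm_sq]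
  rw [@norm_sub_sq ℂ, h2]
  nlinarith [norm_nonneg (T (adjoint T x))]

theorem nonneg_one_sub_mul_adjoint {T : E →L[ℂ] E} (hT : ‖T‖ ≤ 1) : 0 ≤ 1 - T * adjoint T := by
  rw [nonneg_iff_isPositive, isPositive_iff_complex]
  intro x
  have h1 : ⟪(1 - T * adjoint T) x, x⟫_ℂ = ((‖x‖ ^ 2 - ‖adjoint T x‖ ^ 2 : ℝ) : ℂ) := by
    rw [sub_apply, inner_sub_left, mul_apply_eq_comp, one_apply_eq_self,
      ← adjoint_inner_right T, inner_self_eq_norm_sq_to_K, inner_self_eq_norm_sq_to_K]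
    simp
  have h2 : ‖adjoint T x‖ ≤ ‖x‖ := by
    simpa using (adjoint T).le_of_opNorm_le ((adjoint.norm_map T).trans_le hT) x
  rw [h1]
  refine ⟨by rw [RCLike.re_to_complex, Complex.ofReal_re], ?_⟩
  have := norm_nonneg (adjoint T x)
  simp only [RCLike.re_to_complex, Complex.ofReal_re]
  nlinarith

/-- A series of positive rank one operators that converges strongly converges strongly
unconditionally. -/
theorem hasSum_rankOne_of_tendsto {ξ : ℕ → E} {T : E →L[ℂ] E}
    (h : ∀ x, Tendsto (fun k => ∑ j ∈ range k, rankOne ℂ (ξ j) (ξ j) x) atTop (𝓝 (T x)))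
    (x : E) : HasSum (fun j => rankOne ℂ (ξ j) (ξ j) x) (T x) := by
  have hq (x : E) : HasSum (fun j => ‖⟪ξ j, x⟫_ℂ‖ ^ 2) (RCLike.re ⟪T x, x⟫_ℂ) := by
    rw [hasSum_iff_tendsto_nat_of_nonneg fun _ => by positivity]
    refine ((RCLike.continuous_re.tendsto _).comp ((h x).inner tendsto_const_nhds)).congr
      fun k => ?_
    rw [Function.comp_apply, sum_inner, map_sum]
    refine sum_congr rfl fun j _ => ?_
    rw [rankOne_apply, inner_smul_left, RCLike.conj_mul, ← RCLike.ofReal_pow, RCLike.ofReal_re]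
  have hC (x : E) (s : Finset ℕ) : ∑ j ∈ s, ‖⟪ξ j, x⟫_ℂ‖ ^ 2 ≤ ‖T‖ * ‖x‖ ^ 2 :=
    calc _ ≤ _ := sum_le_hasSum s (fun _ _ => by positivity) (hq x)
      _ ≤ ‖T x‖ * ‖x‖ := (RCLike.re_le_norm _).trans (norm_inner_le_norm _ _)
      _ ≤ _ := by nlinarith [T.le_opNorm x, norm_nonneg x]
  -- The scalar series has nonnegative terms, so its Cauchy criterion over finite sets transfers to
  -- the vectors.
  have hs : Summable fun j => rankOne ℂ (ξ j) (ξ j) x := by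
    rw [summable_iff_vanishing_norm]
    intro ε hε
    obtain ⟨s, hs⟩ := summable_iff_vanishing_norm.1 ((hq x).summable.mul_left ‖T‖) (ε ^ 2)
      (by positivity)
    refine ⟨s, fun t ht => lt_of_pow_lt_pow_left₀ 2 hε.le ?_⟩
    refine (norm_sum_rankOne_sq_le hC x t).trans_lt ((hs t ht).trans_le' ?_)
    rw [← mul_sum]
    exact le_abs_self _
  exact (hs.hasSum_iff_tendsto_nat).2 (h x)

end Hilbert

/-! ### Testing on basis vectors -/

/-- The standard basis vectors of `ℓ²`. -/
def basisVec (i : ℕ) : Ell2 := lp.single 2 i 1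

theorem basisVec_apply (i j : ℕ) : basisVec i j = if j = i then 1 else 0 := by
  simp [basisVec, Pi.single_apply]

theorem norm_basisVec (i : ℕ) : ‖basisVec i‖ = 1 := by
  rw [basisVec, lp.norm_single (by norm_num), norm_one]

theorem inner_basisVec_left (i : ℕ) (v : Ell2) : ⟪basisVec i, v⟫_ℂ = v i := by
  rw [basisVec, lp.inner_single_left]
  simp

theorem inner_basisVec_right (i : ℕ) (v : Ell2) : ⟪v, basisVec i⟫_ℂ = conj (v i) := by
  rw [← inner_conj_symm, inner_basisVec_left]

theorem hasSum_smul_basisVec (v : Ell2) : HasSum (fun i => v i • basisVec i) v := by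
  convert lp.hasSum_single (p := 2) (by norm_num) v with i
  rw [basisVec, ← lp.single_smul, smul_eq_mul, mul_one]

theorem ext_basisVec {S T : Ell2 →L[ℂ] Ell2} (h : ∀ i, S (basisVec i) = T (basisVec i)) :
    S = T := by
  ext1 v
  have hS := (hasSum_smul_basisVec v).mapL S
  have hT := (hasSum_smul_basisVec v).mapL T
  simp only [map_smul, h] at hS hT
  exact hS.unique hT

theorem tendsto_zero_of_basisVec {R : ℕ → Ell2 →L[ℂ] Ell2} (hR : ∀ k, ‖R k‖ ≤ 1)
    (h : ∀ i, Tendsto (fun k => R k (basisVec i)) atTop (𝓝 0)) (v : Ell2) :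
    Tendsto (fun k => R k v) atTop (𝓝 0) := by
  rw [Metric.tendsto_atTop']
  intro ε hε
  obtain ⟨s, hs⟩ := ((Metric.tendsto_nhds.1 (hasSum_smul_basisVec v)) (ε / 2) (by positivity)).exists
  have h1 : Tendsto (fun k => R k (∑ i ∈ s, v i • basisVec i)) atTop (𝓝 0) := by
    simp only [map_sum, map_smul]
    simpa using tendsto_finsetSum s fun i _ => (h i).const_smul (v i)
  obtain ⟨K, hK⟩ := Metric.tendsto_atTop'.1 h1 (ε / 2) (by positivity)
  refine ⟨K, fun k hk => ?_⟩
  have h2 := hK k hk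
  have h3 := (R k).le_of_opNorm_le (hR k) (v - ∑ i ∈ s, v i • basisVec i)
  rw [dist_comm, dist_eq_norm] at hs
  rw [dist_zero_right] at h2 ⊢
  calc ‖R k v‖ = ‖R k (v - ∑ i ∈ s, v i • basisVec i) + R k (∑ i ∈ s, v i • basisVec i)‖ := by
        rw [← map_add, sub_add_cancel]
    _ ≤ _ := norm_add_le _ _
    _ < ε := by linarith

theorem IsOperatorOf.apply_basisVec {M : Matrix ℕ ℕ ℂ} {T : Ell2 →L[ℂ] Ell2}
    (hT : IsOperatorOf M T) (i j : ℕ) : T (basisVec j) i = M i j := by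
  have h := hT (basisVec j) i
  simp only [basisVec_apply, mul_ite, mul_one, mul_zero] at h
  exact h.unique (hasSum_ite_eq j _ |>.congr_fun fun k => by split_ifs with h <;> simp [h])

theorem IsOperatorOf.adjoint_apply_basisVec {M : Matrix ℕ ℕ ℂ} {T : Ell2 →L[ℂ] Ell2}
    (hT : IsOperatorOf M T) (i j : ℕ) : adjoint T (basisVec j) i = conj (M j i) := by
  rw [← inner_basisVec_left, adjoint_inner_right, inner_basisVec_right, hT.apply_basisVec]

/-! ### Iterating the recursion for `𝓐` -/

theorem isOperatorOf_Mop {γ : Ell2} (hγ : γ ∈ GammaEll2) : IsOperatorOf (Mmat γ) (Mop γ) :=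
  (isBoundedMatrix_Mmat hγ).isOperatorOf

theorem isOperatorOf_Lop {γ : Ell2} (hγ : γ ∈ GammaEll2) : IsOperatorOf (Lmat γ) (Lop γ) :=
  (isBoundedMatrix_Lmat hγ).isOperatorOf

theorem Mop_mul_adjoint {γ : Ell2} (hγ : γ ∈ GammaEll2) :
    Mop γ * adjoint (Mop γ) = 1 - rankOne ℂ (eta γ) (eta γ) := by
  refine ext_basisVec fun j => ?_
  ext i
  have h : (adjoint (Mop γ) (basisVec j) : ℕ → ℂ) = fun k => conj (Mmat γ j k) :=
    funext fun k => (isOperatorOf_Mop hγ).adjoint_apply_basisVec k j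
  rw [mul_apply_eq_comp, Mop_apply hγ, h, lowerApply_Mmat_conj_Mmat hγ, sub_apply,
    one_apply_eq_self, rankOne_apply, inner_basisVec_right, ← basisVec_apply]
  change _ = basisVec j i - conj (eta γ j) * eta γ i
  ring

/-- `I - 𝔐𝓛𝓛*𝔐* = (I - 𝔐𝔐*) + 𝔐(I - 𝓛𝓛*)𝔐*`, with `𝓛` taken at `Wγ`. -/
theorem A_eq_add {γ : Ell2} (hγ : γ ∈ GammaEll2) :
    A γ = rankOne ℂ (eta γ) (eta γ) + Mop γ * A (W γ) * adjoint (Mop γ) := by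
  have h := Mop_mul_adjoint hγ
  simp only [A, Lop_eq_mul hγ, ← star_eq_adjoint, star_mul] at h ⊢
  rw [mul_sub, sub_mul, mul_one, h]
  simp only [mul_assoc]
  abel

/-- The product `𝔐(γ) 𝔐(Wγ) ⋯ 𝔐(W^{k-1}γ)`. -/
def MopProd (γ : Ell2) (k : ℕ) : Ell2 →L[ℂ] Ell2 :=
  ((List.range k).map fun j => Mop (W^[j] γ)).prod

theorem MopProd_zero (γ : Ell2) : MopProd γ 0 = 1 := rfl

theorem MopProd_succ (γ : Ell2) (k : ℕ) : MopProd γ (k + 1) = MopProd γ k * Mop (W^[k] γ) := by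
  simp [MopProd, List.range_succ]

theorem xi_eq (γ : Ell2) (j : ℕ) : xi γ j = MopProd γ j (eta (W^[j] γ)) := rfl

theorem norm_MopProd_le {γ : Ell2} (hγ : γ ∈ GammaEll2) (k : ℕ) : ‖MopProd γ k‖ ≤ 1 := by
  induction k with
  | zero => exact norm_id_le
  | succ k ih =>
    rw [MopProd_succ]
    exact (norm_mul_le _ _).trans
      (mul_le_one₀ ih (norm_nonneg _) (norm_Mop_le (W_iterate_mem hγ k)))

theorem A_eq_sum_add {γ : Ell2} (hγ : γ ∈ GammaEll2) (k : ℕ) :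
    A γ = ∑ j ∈ range k, rankOne ℂ (xi γ j) (xi γ j) +
      MopProd γ k * A (W^[k] γ) * adjoint (MopProd γ k) := by
  induction k with
  | zero => simp [MopProd_zero, ← star_eq_adjoint]
  | succ k ih =>
    have h : rankOne ℂ (xi γ k) (xi γ k) = MopProd γ k *
        rankOne ℂ (eta (W^[k] γ)) (eta (W^[k] γ)) * adjoint (MopProd γ k) := by
      change _ = (MopProd γ k ∘L _) ∘L _
      rw [comp_rankOne, rankOne_comp, adjoint_adjoint, xi_eq]
    rw [ih, A_eq_add (W_iterate_mem hγ k), sum_range_succ, h, MopProd_succ,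
      Function.iterate_succ_apply']
    simp only [← star_eq_adjoint, star_mul, mul_add, add_mul, mul_assoc, add_assoc]

/-! ### The remainder vanishes -/

theorem norm_A_le {γ : Ell2} (hγ : γ ∈ GammaEll2) : ‖A γ‖ ≤ 1 := by
  refine opNorm_le_bound _ zero_le_one fun v => ?_
  have h := norm_sub_apply_adjoint_sq_le (norm_Lop_le hγ) v
  rw [one_mul]
  refine (sq_le_sq₀ (norm_nonneg _) (norm_nonneg _)).1 (h.trans ?_)
  exact sub_le_self _ (by positivity)

/-- The diagonal entry `Π_{i+1}` of `𝓛` bounds the norm of `𝓛* e_i` from below. -/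
theorem norm_A_basisVec_sq_le {γ : Ell2} (hγ : γ ∈ GammaEll2) (i : ℕ) :
    ‖A γ (basisVec i)‖ ^ 2 ≤ 1 - Pi γ (i + 1) ^ 2 := by
  have h := norm_sub_apply_adjoint_sq_le (norm_Lop_le hγ) (basisVec i)
  have h1 := lp.norm_apply_le_norm (p := 2) (by norm_num) (adjoint (Lop γ) (basisVec i)) i
  have h2 := Lmat_add γ 0 i
  rw [add_zero, Lcoef_zero, mul_one] at h2
  rw [(isOperatorOf_Lop hγ).adjoint_apply_basisVec, RCLike.norm_conj, h2, Complex.norm_real,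
    Real.norm_of_nonneg (Pi_nonneg hγ _)] at h1
  rw [norm_basisVec] at h
  have h3 := pow_le_pow_left₀ (Pi_nonneg hγ _) h1 2
  refine h.trans ?_
  linarith

theorem tendsto_A_basisVec {γ : Ell2} (hγ : γ ∈ GammaEll2) (i : ℕ) :
    Tendsto (fun k => ‖A (W^[k] γ) (basisVec i)‖) atTop (𝓝 0) := by
  have h1 : Tendsto (fun k => 1 - Pi (W^[k] γ) (i + 1) ^ 2) atTop (𝓝 0) := by
    simpa using ((tendsto_Pi hγ (i + 1)).pow 2).const_sub 1
  have h2 := squeeze_zero (fun k => sq_nonneg _)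
    (fun k => norm_A_basisVec_sq_le (W_iterate_mem hγ k) i) h1
  simpa using h2.sqrt

theorem norm_apply_le_of_support (T : Ell2 →L[ℂ] Ell2) {v : Ell2} {N : ℕ}
    (hv : ∀ i, N < i → v i = 0) :
    ‖T v‖ ≤ ‖v‖ * ∑ i ∈ range (N + 1), ‖T (basisVec i)‖ := by
  have h : v = ∑ i ∈ range (N + 1), v i • basisVec i :=
    (hasSum_smul_basisVec v).unique <| hasSum_sum_of_ne_finset_zero fun i hi => by
      rw [hv i (by rw [mem_range] at hi; omega), zero_smul]
  have h2 : T v = ∑ i ∈ range (N + 1), v i • T (basisVec i) := by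
    conv_lhs => rw [h]
    simp only [map_sum, map_smul]
  rw [h2, mul_sum]
  refine norm_sum_le_of_le _ fun i _ => ?_
  rw [norm_smul]
  exact mul_le_mul_of_nonneg_right (lp.norm_apply_le_norm (p := 2) (by norm_num) v i)
    (norm_nonneg _)

theorem adjoint_Mop_apply_eq_zero {γ : Ell2} (hγ : γ ∈ GammaEll2) {v : Ell2} {N : ℕ}
    (hv : ∀ i, N < i → v i = 0) (i : ℕ) (hi : N < i) : adjoint (Mop γ) v i = 0 := by
  rw [← inner_basisVec_left, adjoint_inner_right, lp.inner_eq_tsum]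
  refine (tsum_congr fun j => ?_).trans tsum_zero
  rw [(isOperatorOf_Mop hγ).apply_basisVec]
  rcases le_or_gt j N with h | h
  · rw [Mmat_of_lt γ _ _ (h.trans_lt hi), inner_zero_left]
  · rw [hv j h, inner_zero_right]

theorem adjoint_MopProd_basisVec_apply_eq_zero {γ : Ell2} (hγ : γ ∈ GammaEll2) (N k : ℕ) :
    ∀ i, N < i → adjoint (MopProd γ k) (basisVec N) i = 0 := by
  induction k with
  | zero =>
    intro i hi
    rw [MopProd_zero, ← star_eq_adjoint, star_one, one_apply_eq_self, basisVec_apply,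
      if_neg hi.ne']
  | succ k ih =>
    rw [MopProd_succ, ← star_eq_adjoint, star_mul]
    exact adjoint_Mop_apply_eq_zero (W_iterate_mem hγ k) ih

theorem norm_adjoint_MopProd_le {γ : Ell2} (hγ : γ ∈ GammaEll2) (k : ℕ) :
    ‖adjoint (MopProd γ k)‖ ≤ 1 :=
  (adjoint.norm_map _).trans_le (norm_MopProd_le hγ k)

theorem tendsto_remainder {γ : Ell2} (hγ : γ ∈ GammaEll2) (v : Ell2) :
    Tendsto (fun k => (MopProd γ k * A (W^[k] γ) * adjoint (MopProd γ k)) v) atTop (𝓝 0) := by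
  refine tendsto_zero_of_basisVec (fun k => ?_) (fun N => ?_) v
  · refine (norm_mul_le _ _).trans (mul_le_one₀ ((norm_mul_le _ _).trans
      (mul_le_one₀ (norm_MopProd_le hγ k) (norm_nonneg _) (norm_A_le (W_iterate_mem hγ k))))
      (norm_nonneg _) (norm_adjoint_MopProd_le hγ k))
  -- The vector `adjoint (MopProd γ k) (basisVec N)` moves with `k` but stays in the unit ball of
  -- the span of `e_0, …, e_N`, so decay on these finitely many basis vectors suffices.
  · refine squeeze_zero_norm (a := fun k => ∑ i ∈ range (N + 1), ‖A (W^[k] γ) (basisVec i)‖)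
      (fun k => ?_) (by simpa using tendsto_finsetSum (range (N + 1)) (fun i _ =>
        tendsto_A_basisVec hγ i))
    rw [mul_apply_eq_comp, mul_apply_eq_comp]
    have h1 := (adjoint (MopProd γ k)).le_of_opNorm_le (norm_adjoint_MopProd_le hγ k) (basisVec N)
    rw [norm_basisVec, one_mul] at h1
    refine ((MopProd γ k).le_of_opNorm_le (norm_MopProd_le hγ k) _).trans ?_
    rw [one_mul]
    exact (norm_apply_le_of_support _ (adjoint_MopProd_basisVec_apply_eq_zero hγ N k)).trans
      (mul_le_of_le_one_left (sum_nonneg fun _ _ => norm_nonneg _) h1)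

theorem tendsto_sum_rankOne_xi {γ : Ell2} (hγ : γ ∈ GammaEll2) (v : Ell2) :
    Tendsto (fun k => ∑ j ∈ range k, rankOne ℂ (xi γ j) (xi γ j) v) atTop (𝓝 (A γ v)) := by
  have h := (tendsto_remainder hγ v).const_sub (A γ v)
  rw [sub_zero] at h
  refine h.congr fun k => ?_
  conv_lhs => rw [A_eq_sum_add hγ k]
  rw [add_apply, add_sub_cancel_right, _root_.sum_apply]

end SchurParam

end

theorem theorem6p13 (γ : SchurParam.Ell2) (hγ : γ ∈ SchurParam.GammaEll2) :
    SchurParam.IsBoundedMatrix (SchurParam.Lmat γ) ∧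
    (∀ k : ℕ, SchurParam.IsBoundedMatrix (SchurParam.Mmat (SchurParam.W^[k] γ))) ∧
    0 ≤ SchurParam.A γ ∧ SchurParam.A γ ≤ 1 ∧
    ∀ h : SchurParam.Ell2,
      HasSum (fun j : ℕ => InnerProductSpace.rankOne ℂ (SchurParam.xi γ j) (SchurParam.xi γ j) h)
        (SchurParam.A γ h) := by
  refine ⟨SchurParam.isBoundedMatrix_Lmat hγ,
    fun k => SchurParam.isBoundedMatrix_Mmat (SchurParam.W_iterate_mem hγ k),
    SchurParam.nonneg_one_sub_mul_adjoint (SchurParam.norm_Lop_le hγ), ?_,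
    SchurParam.hasSum_rankOne_of_tendsto (SchurParam.tendsto_sum_rankOne_xi hγ)⟩
  -- `I - 𝓐 = 𝓛𝓛*` is positive.
  rw [← sub_nonneg, SchurParam.A, sub_sub_cancel]
  exact mul_star_self_nonneg (SchurParam.Lop γ)
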